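/- For a permutation $w$ of $\{1,\dots,n\}$ let $\mathrm{des}(w)=|\{1\le i\le n-1 : w(i)>w(i+1)\}|$, let $S_n^{+}$ and $S_n^{-}$ be the sets of even and odd permutations of $\{1,\dots,n\}$, and let $$A_n^{\pm}(t)=\sum_{k=1}^{n} a_{n,k}^{\pm}\,t^k,\qquad a_{n,k}^{\pm}=|\{w\in S_n^{\pm} : \mathrm{des}(w)=k-1\}|.$$ For $n\ge 2$ let $W_n^{\pm}$ be a random variable with $\mathbb P(W_n^{\pm}=k)=a_{n,k}^{\pm}/A_n^{\pm}(1)$ for $1\le k\le n$, where $A_n^{\pm}(1)=|S_n^{\pm}|$. Then, for each choice of the sign $\pm$: (1) the distribution of the coefficients of $A_n^{\pm}(t)$ is asymptotically normal as $n\to\infty$, that is, for every real $x$, $$\lim_{n\to\infty}\mathbb P\left(\frac{W_n^{\pm}-\mathbb E[W_n^{\pm}]}{\sqrt{\mathrm{Var}(W_n^{\pm})}}\le x\right)=\frac1{\sqrt{2\pi}}\int_{-\infty}^{x}e^{-u^2/2}\,du;$$ (2) for every $n\ge 4$, $\mathbb E[W_n^{\pm}]=(n+1)/2$; (3) for every $n\ge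 6$, $\mathrm{Var}(W_n^{\pm})=(n+1)/12$. -/

import Mathlib

open Filter Topology MeasureTheory ProbabilityTheory
open scoped ENNReal Polynomial

/-- The number of descents of a permutation `w` of an `n`-element chain: the number of positions
`i` that have a successor `i + 1` and satisfy `w (i + 1) < w i`. -/
def des {n : ℕ} (w : Equiv.Perm (Fin n)) : ℕ :=
  (Finset.univ.filter fun i : Fin n => ∃ h : (i : ℕ) + 1 < n, w ⟨(i : ℕ) + 1, h⟩ < w i).card

/-- The positive (`ε = 1`) and negative (`ε = -1`) Eulerian numbers: the number of permutations
of sign `ε` with `k - 1` descents. -/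
def signedEulerian (ε : ℤˣ) (n k : ℕ) : ℕ :=
  (Finset.univ.filter fun w : Equiv.Perm (Fin n) =>
    Equiv.Perm.sign w = ε ∧ des w + 1 = k).card

/-- The positive (`ε = 1`) and negative (`ε = -1`) Eulerian polynomials. -/
noncomputable def signedEulerianPoly (ε : ℤˣ) (n : ℕ) : ℕ[X] :=
  ∑ k ∈ Finset.Icc 1 n, Polynomial.monomial k (signedEulerian ε n k)

/-- The distribution of the coefficients of a polynomial `p` with natural number coefficients:
the measure on `ℝ` that gives the point `k` the mass `p.coeff k / p(1)`, where `p(1)` is the sum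
of all coefficients. It is a probability measure whenever `p ≠ 0`. -/
noncomputable def coeffDistribution (p : ℕ[X]) : Measure ℝ :=
  ∑ k ∈ p.support, ((p.coeff k : ℝ≥0∞) / ((p.eval 1 : ℕ) : ℝ≥0∞)) • Measure.dirac (k : ℝ)

/-- A sequence of distributions on `ℝ` is asymptotically normal if (from some index on) its terms
are probability measures with finite second moment and, after normalization by their own mean and
standard deviation, their distribution functions converge pointwise to the distribution function
of the standard normal law. -/
def AsymptoticallyNormal (μ : ℕ → Measure ℝ) : Prop :=
  (∀ᶠ n in atTop, IsProbabilityMeasure (μ n) ∧ MemLp id 2 (μ n)) ∧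
  ∀ x : ℝ, Tendsto
    (fun n => (μ n).real {y : ℝ | (y - ∫ z, z ∂(μ n)) / √(variance id (μ n)) ≤ x})
    atTop (𝓝 ((gaussianReal 0 1).real (Set.Iic x)))

/-!
Write a sum over the permutations of sign `ε` as half of the sum over all permutations plus half of
`ε` times the signed sum. The signed sum contributes nothing to the first two moments of the number
of descents, and little to its law; what is left is the classical Eulerian distribution.

*Signed sums.* If a function of `w` does not look at two of the positions, then composing with their
transposition shows that its signed sum is zero. The number of descents is a sum of indicators of
two positions each, and its square a sum of functions of at most four positions, so the signed first
moment vanishes once `n ≥ 4` and the signed second moment once `n ≥ 6`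
(`sum_sign_mul_des_sub_half`, `sum_sign_mul_des_sub_half_sq`). For an arbitrary bounded function of
the number of descents, interchange the values `0` and `1`: this reverses the sign and keeps all
descents unless these values are at adjacent positions, which happens for at most `2 / (n - 1)` of
all permutations (`norm_sum_sign_mul_des_le`).

*Moments.* After centring, the indicators of descents at positions that are not adjacent are
uncorrelated, and those at adjacent positions have covariance `-1/12`, which gives mean
`(n - 1) / 2` and variance `(n + 1) / 12` for the number of descents of a uniform permutation.

*Limit law.* The ranks of independent uniform variables `V₀, …, Vₙ` form a uniform permutation, and
`Vₙ + des V` is the sum of the fractional parts of the increments `Vᵢ - Vᵢ₋₁` (with `V₋₁ = 0`),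
which are again independent and uniform (`integral_realChar_last_add_seqDescents`). So the number of
descents differs by at most one from a sum of independent uniform variables, to which the central
limit theorem applies. All comparisons are made between characteristic functions
(`norm_integral_realChar_descentLaw_sub_le`), and Lévy's continuity theorem concludes.
-/

/-! ### Descents of sequences -/

/-- The number of descents of a finite sequence in a linear order. -/
def seqDescents {α : Type*} [LinearOrder α] {n : ℕ} (v : Fin n → α) : ℕ :=
  (Finset.univ.filter fun i : Fin n => ∃ h : (i : ℕ) + 1 < n, v ⟨(i : ℕ) + 1, h⟩ < v i).card

lemma des_eq_seqDescents {n : ℕ} (w : Equiv.Perm (Fin n)) : des w = seqDescents w := rfl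

lemma seqDescents_succ {α : Type*} [LinearOrder α] {n : ℕ} (v : Fin (n + 1) → α) :
    seqDescents v = ∑ i : Fin n, if v i.succ < v i.castSucc then 1 else 0 := by
  rw [seqDescents, Finset.card_filter, Fin.sum_univ_castSucc]
  simp [Fin.succ]

lemma seqDescents_snoc {α : Type*} [LinearOrder α] {n : ℕ} (v : Fin (n + 1) → α) (x : α) :
    seqDescents (Fin.snoc v x : Fin (n + 2) → α) =
      seqDescents v + if x < v (Fin.last n) then 1 else 0 := by
  rw [seqDescents_succ, seqDescents_succ, Fin.sum_univ_castSucc]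
  congr 1
  · refine Finset.sum_congr rfl fun i _ => ?_
    rw [Fin.succ_castSucc, Fin.snoc_castSucc, Fin.snoc_castSucc]
  · rw [Fin.succ_last, Fin.snoc_last, Fin.snoc_castSucc]

lemma seqDescents_comp_strictMono {α β : Type*} [LinearOrder α] [LinearOrder β] {n : ℕ}
    {m : α → β} (hm : StrictMono m) (v : Fin n → α) : seqDescents (m ∘ v) = seqDescents v := by
  simp [seqDescents, hm.lt_iff_lt]

lemma seqDescents_succ_le {α : Type*} [LinearOrder α] {n : ℕ} (v : Fin (n + 1) → α) :
    seqDescents v ≤ n := by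
  rw [seqDescents_succ]
  refine (Finset.sum_le_sum (g := fun _ => 1) fun i _ => ?_).trans (by simp)
  split_ifs <;> simp

/-! ### Cancellation in signed sums over descents -/

/-- Interchanging the two smallest values changes the relative order of no other pair of values. -/
lemma swap_zero_one_lt_iff {n : ℕ} {a b : Fin (n + 2)} (h₁ : ¬(a = 0 ∧ b = 1))
    (h₂ : ¬(a = 1 ∧ b = 0)) :
    Equiv.swap (0 : Fin (n + 2)) 1 a < Equiv.swap (0 : Fin (n + 2)) 1 b ↔ a < b := by
  simp only [Equiv.swap_apply_def]
  split_ifs <;> simp only [Fin.lt_def, Fin.ext_iff, Fin.val_zero, Fin.val_one] at * <;> omega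

/-- Two positions are neighbours if they differ by one. -/
def Neighbours {n : ℕ} (a b : Fin n) : Prop := (a : ℕ) + 1 = b ∨ (b : ℕ) + 1 = a

instance {n : ℕ} (a b : Fin n) : Decidable (Neighbours a b) := by
  unfold Neighbours; infer_instance

lemma des_swap_mul {n : ℕ} (w : Equiv.Perm (Fin (n + 2)))
    (h : ¬ Neighbours (w⁻¹ 0) (w⁻¹ 1)) : des (Equiv.swap 0 1 * w) = des w := by
  rw [des_eq_seqDescents, des_eq_seqDescents, seqDescents_succ, seqDescents_succ]
  refine Finset.sum_congr rfl fun i _ => ?_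
  have key : ∀ a b, w a = 0 ∧ w b = 1 → w⁻¹ 0 = a ∧ w⁻¹ 1 = b := by
    rintro a b ⟨ha, hb⟩
    simp [← ha, ← hb]
  have h₁ : ¬(w i.succ = 0 ∧ w i.castSucc = 1) := fun hc => by
    obtain ⟨h0, h1⟩ := key _ _ hc
    exact h (by rw [h0, h1]; right; simp)
  have h₂ : ¬(w i.succ = 1 ∧ w i.castSucc = 0) := fun hc => by
    obtain ⟨h0, h1⟩ := key _ _ hc.symm
    exact h (by rw [h0, h1]; left; simp)
  simp only [Equiv.Perm.mul_apply, swap_zero_one_lt_iff h₁ h₂]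

lemma card_neighbours_le {n : ℕ} (a : Fin n) :
    (Finset.univ.filter fun b : Fin n => Neighbours a b).card ≤ 2 := by
  have : ((Finset.univ.filter fun b : Fin n => Neighbours a b).image (Fin.val)) ⊆
      {(a : ℕ) + 1, (a : ℕ) - 1} := by
    intro x
    simp only [Finset.mem_image, Finset.mem_filter, Finset.mem_univ, true_and, Finset.mem_insert,
      Finset.mem_singleton, forall_exists_index, and_imp]
    -- The truncated `0 - 1 = 0` does no harm: the point `0` has no left neighbour.
    rintro b (h | h) rfl <;> omega
  rw [← Finset.card_image_of_injective _ Fin.val_injective]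
  exact (Finset.card_le_card this).trans Finset.card_le_two

/-- Few permutations send two given points to neighbours. All pairs `0, j` with `j ≠ 0` are
equivalent for this count, and for each permutation at most two of the `j` qualify. -/
lemma card_neighbours_perm_le (n : ℕ) :
    (n + 1) * (Finset.univ.filter fun u : Equiv.Perm (Fin (n + 2)) =>
      Neighbours (u 0) (u 1)).card ≤ 2 * (n + 2).factorial := by
  have heq : ∀ j : Fin (n + 1), (Finset.univ.filter fun u : Equiv.Perm (Fin (n + 2)) =>
      Neighbours (u 0) (u j.succ)).card = (Finset.univ.filter fun u : Equiv.Perm (Fin (n + 2)) =>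
      Neighbours (u 0) (u 1)).card := by
    intro j
    rw [Finset.card_filter, Finset.card_filter,
      ← Equiv.sum_comp (Equiv.mulRight (Equiv.swap (1 : Fin (n + 2)) j.succ))]
    refine Finset.sum_congr rfl fun u _ => ?_
    simp only [Equiv.coe_mulRight, Equiv.Perm.mul_apply, Equiv.swap_apply_right]
    rw [Equiv.swap_apply_of_ne_of_ne (by simp) (Fin.succ_ne_zero j).symm]
  calc _ = ∑ j : Fin (n + 1), (Finset.univ.filter fun u : Equiv.Perm (Fin (n + 2)) =>
        Neighbours (u 0) (u j.succ)).card := by simp [heq]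
    _ = ∑ u : Equiv.Perm (Fin (n + 2)), ∑ j : Fin (n + 1),
          if Neighbours (u 0) (u j.succ) then 1 else 0 := by
        simp only [Finset.card_filter]
        exact Finset.sum_comm
    _ ≤ ∑ u : Equiv.Perm (Fin (n + 2)), 2 := by
        refine Finset.sum_le_sum fun u _ => ?_
        calc _ ≤ ∑ j : Fin (n + 2), if Neighbours (u 0) (u j) then 1 else 0 := by
              rw [Fin.sum_univ_succ (n := n + 1)]; exact Nat.le_add_left _ _
          _ = ∑ j : Fin (n + 2), if Neighbours (u 0) j then 1 else 0 :=
              Equiv.sum_comp u fun j => if Neighbours (u 0) j then 1 else 0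
          _ ≤ 2 := by rw [← Finset.card_filter]; exact card_neighbours_le _
    _ = 2 * (n + 2).factorial := by
        simp [Fintype.card_perm, mul_comm]

/-- A signed sum vanishes if an odd permutation acts without changing the summand. -/
lemma sum_sign_mul_eq_zero {n : ℕ} {R : Type*} [Field R] [CharZero R]
    (f : Equiv.Perm (Fin n) → R) (e : Equiv.Perm (Equiv.Perm (Fin n)))
    (he : ∀ w, Equiv.Perm.sign (e w) = -Equiv.Perm.sign w) (hf : ∀ w, f (e w) = f w) :
    ∑ w, ((Equiv.Perm.sign w : ℤ) : R) * f w = 0 := by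
  have h := Equiv.sum_comp e fun w => ((Equiv.Perm.sign w : ℤ) : R) * f w
  simp only [he, hf, Units.val_neg, Int.cast_neg, neg_mul, Finset.sum_neg_distrib] at h
  exact self_eq_neg.mp h.symm

/-- Interchanging the values `0` and `1` cancels the terms in which these are not at neighbouring
positions; the remaining terms are few. -/
lemma norm_sum_sign_mul_des_le {n : ℕ} (f : ℕ → ℂ) (hf : ∀ k, ‖f k‖ ≤ 1) :
    (n + 1) * ‖∑ w : Equiv.Perm (Fin (n + 2)), ((Equiv.Perm.sign w : ℤ) : ℂ) * f (des w)‖ ≤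
      2 * ((n + 2).factorial : ℝ) := by
  set g : Equiv.Perm (Fin (n + 2)) → ℂ :=
    fun w => if Neighbours (w⁻¹ 0) (w⁻¹ 1) then f (des w) else 0
  set g' : Equiv.Perm (Fin (n + 2)) → ℂ :=
    fun w => if Neighbours (w⁻¹ 0) (w⁻¹ 1) then 0 else f (des w)
  have hg' : ∑ w, ((Equiv.Perm.sign w : ℤ) : ℂ) * g' w = 0 := by
    refine sum_sign_mul_eq_zero g' (Equiv.mulLeft (Equiv.swap 0 1)) (fun w => ?_) fun w => ?_
    · simp
    · have hsymm : Neighbours (w⁻¹ 1) (w⁻¹ 0) ↔ Neighbours (w⁻¹ 0) (w⁻¹ 1) := or_comm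
      simp only [g', Equiv.coe_mulLeft, mul_inv_rev, Equiv.swap_inv, Equiv.Perm.mul_apply,
        Equiv.swap_apply_left, Equiv.swap_apply_right, hsymm]
      split_ifs with h
      · rfl
      · rw [des_swap_mul w h]
  have hsplit : ∑ w : Equiv.Perm (Fin (n + 2)), ((Equiv.Perm.sign w : ℤ) : ℂ) * f (des w) =
      ∑ w, ((Equiv.Perm.sign w : ℤ) : ℂ) * g w := by
    rw [← add_zero (∑ w, _ * g w), ← hg', ← Finset.sum_add_distrib]
    refine Finset.sum_congr rfl fun w _ => ?_
    simp only [g, g']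
    split_ifs <;> simp
  have hbound : ‖∑ w, ((Equiv.Perm.sign w : ℤ) : ℂ) * g w‖ ≤
      ((Finset.univ.filter fun u : Equiv.Perm (Fin (n + 2)) =>
        Neighbours (u 0) (u 1)).card : ℝ) := by
    rw [Finset.card_filter, Nat.cast_sum, ← Equiv.sum_comp (Equiv.inv _)]
    refine (norm_sum_le _ _).trans (Finset.sum_le_sum fun w _ => ?_)
    have hs : ‖((Equiv.Perm.sign w⁻¹ : ℤ) : ℂ)‖ = 1 := by
      rcases Int.units_eq_one_or (Equiv.Perm.sign w⁻¹) with h | h <;> simp [h]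
    rw [Equiv.inv_apply, norm_mul, hs, one_mul]
    simp only [g, inv_inv]
    split_ifs
    · simpa using hf _
    · simp
  rw [hsplit]
  have := card_neighbours_perm_le n
  calc _ ≤ ((n : ℝ) + 1) * ((Finset.univ.filter fun u : Equiv.Perm (Fin (n + 2)) =>
        Neighbours (u 0) (u 1)).card : ℝ) := by gcongr
    _ ≤ _ := by exact_mod_cast this

/-! ### Moments of the descent number -/

/-- The centred indicator of the event that `w` takes a smaller value at `b` than at `a`. -/
noncomputable def centredInv {n : ℕ} (a b : Fin n) (w : Equiv.Perm (Fin n)) : ℝ :=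
  (if w b < w a then 1 else 0) - 1 / 2

lemma centredInv_mul {n : ℕ} (a b : Fin n) (w σ : Equiv.Perm (Fin n)) :
    centredInv a b (w * σ) = centredInv (σ a) (σ b) w := rfl

lemma centredInv_symm {n : ℕ} {a b : Fin n} (hab : a ≠ b) (w : Equiv.Perm (Fin n)) :
    centredInv b a w = -centredInv a b w := by
  rcases lt_or_gt_of_ne (w.injective.ne hab) with h | h <;>
    simp only [centredInv, h, h.not_gt, if_true, if_false] <;> norm_num

lemma centredInv_mul_self {n : ℕ} (a b : Fin n) (w : Equiv.Perm (Fin n)) :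
    centredInv a b w * centredInv a b w = 1 / 4 := by
  unfold centredInv
  split_ifs <;> norm_num

lemma sum_centredInv {n : ℕ} {a b : Fin n} (hab : a ≠ b) : ∑ w, centredInv a b w = 0 := by
  have h := Equiv.sum_comp (Equiv.mulRight (Equiv.swap a b)) (centredInv a b)
  simp only [Equiv.coe_mulRight, centredInv_mul, Equiv.swap_apply_left, Equiv.swap_apply_right,
    centredInv_symm hab, Finset.sum_neg_distrib] at h
  exact self_eq_neg.mp h.symm

lemma sum_centredInv_mul_of_disjoint {n : ℕ} {a b c d : Fin n} (hab : a ≠ b) (hca : c ≠ a)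
    (hcb : c ≠ b) (hda : d ≠ a) (hdb : d ≠ b) :
    ∑ w, centredInv a b w * centredInv c d w = 0 := by
  have h := Equiv.sum_comp (Equiv.mulRight (Equiv.swap a b))
    fun w => centredInv a b w * centredInv c d w
  simp only [Equiv.coe_mulRight, centredInv_mul, Equiv.swap_apply_left, Equiv.swap_apply_right,
    Equiv.swap_apply_of_ne_of_ne hca hcb, Equiv.swap_apply_of_ne_of_ne hda hdb,
    centredInv_symm hab, neg_mul, Finset.sum_neg_distrib] at h
  exact self_eq_neg.mp h.symm

/-- Around a triangle of positions the inverted pairs number one or two, so the three centred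
indicators add up to `±1/2`; their pairwise correlations agree by cyclic symmetry. -/
lemma sum_centredInv_mul_consecutive {n : ℕ} {a b c : Fin n} (hab : a ≠ b) (hbc : b ≠ c)
    (hca : c ≠ a) :
    ∑ w, centredInv a b w * centredInv b c w = -(n.factorial : ℝ) / 12 := by
  set σ : Equiv.Perm (Fin n) := Equiv.swap a b * Equiv.swap b c
  have ha : σ a = b := by
    simp [σ, Equiv.swap_apply_of_ne_of_ne hab hca.symm]
  have hb : σ b = c := by
    simp [σ, Equiv.swap_apply_of_ne_of_ne hca hbc.symm]
  have hc : σ c = a := by simp [σ]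
  have h₁ := Equiv.sum_comp (Equiv.mulRight σ) fun w => centredInv a b w * centredInv b c w
  have h₂ := Equiv.sum_comp (Equiv.mulRight σ) fun w => centredInv b c w * centredInv c a w
  simp only [Equiv.coe_mulRight, centredInv_mul, ha, hb, hc] at h₁ h₂
  have hpt : ∀ w : Equiv.Perm (Fin n), centredInv a b w * centredInv b c w +
      centredInv b c w * centredInv c a w + centredInv c a w * centredInv a b w = -1 / 4 := by
    intro w
    have h1 := w.injective.ne hab
    have h2 := w.injective.ne hbc
    have h3 := w.injective.ne hca
    unfold centredInv
    split_ifs <;> first | (exfalso; order) | norm_num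
  have hsum := Finset.sum_congr rfl fun w (_ : w ∈ Finset.univ) => hpt w
  rw [Finset.sum_add_distrib, Finset.sum_add_distrib, h₂, h₁] at hsum
  simp only [Finset.sum_const, Finset.card_univ, Fintype.card_perm, Fintype.card_fin,
    nsmul_eq_mul] at hsum
  linarith

/-- A signed sum vanishes if the summand does not see two of the positions. -/
lemma sum_sign_mul_eq_zero_of_unused {n : ℕ} (f : Equiv.Perm (Fin n) → ℝ) (s : Finset (Fin n))
    (hs : s.card + 2 ≤ n)
    (hf : ∀ w σ : Equiv.Perm (Fin n), (∀ a ∈ s, σ a = a) → f (w * σ) = f w) :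
    ∑ w, ((Equiv.Perm.sign w : ℤ) : ℝ) * f w = 0 := by
  have hcard : 1 < sᶜ.card := by rw [Finset.card_compl, Fintype.card_fin]; omega
  obtain ⟨p, hp, q, hq, hpq⟩ := Finset.one_lt_card.mp hcard
  rw [Finset.mem_compl] at hp hq
  refine sum_sign_mul_eq_zero f (Equiv.mulRight (Equiv.swap p q)) (fun w => ?_) fun w => ?_
  · simp [Equiv.Perm.sign_swap hpq]
  · refine hf w _ fun a ha => Equiv.swap_apply_of_ne_of_ne ?_ ?_ <;> rintro rfl <;> contradiction

lemma sum_sign_mul_centredInv {n : ℕ} (hn : 4 ≤ n) (a b : Fin n) :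
    ∑ w, ((Equiv.Perm.sign w : ℤ) : ℝ) * centredInv a b w = 0 := by
  refine sum_sign_mul_eq_zero_of_unused _ {a, b} ?_ fun w σ hσ => ?_
  · have := Finset.card_le_two (a := a) (b := b); omega
  · rw [centredInv_mul, hσ a (by simp), hσ b (by simp)]

lemma sum_sign_mul_centredInv_mul {n : ℕ} (hn : 6 ≤ n) (a b c d : Fin n) :
    ∑ w, ((Equiv.Perm.sign w : ℤ) : ℝ) * (centredInv a b w * centredInv c d w) = 0 := by
  refine sum_sign_mul_eq_zero_of_unused _ {a, b, c, d} ?_ fun w σ hσ => ?_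
  · have := Finset.card_le_four (a := a) (b := b) (c := c) (d := d); omega
  · rw [centredInv_mul, centredInv_mul, hσ a (by simp), hσ b (by simp), hσ c (by simp),
      hσ d (by simp)]

lemma des_sub_half {n : ℕ} (w : Equiv.Perm (Fin (n + 1))) :
    (des w : ℝ) - n / 2 = ∑ i : Fin n, centredInv i.castSucc i.succ w := by
  rw [des_eq_seqDescents, seqDescents_succ]
  simp only [centredInv, Finset.sum_sub_distrib]
  simp [div_eq_mul_inv]

lemma sum_centredInv_mul_eq {n : ℕ} (i j : Fin n) :
    ∑ w, centredInv i.castSucc i.succ w * centredInv j.castSucc j.succ w =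
      ((n + 1).factorial : ℝ) *
        (if i = j then 1 / 4 else if Neighbours i j then -1 / 12 else 0) := by
  split_ifs with h₁ h₂
  · subst h₁
    simp [centredInv_mul_self, Fintype.card_perm]
  · rcases h₂ with h | h
    · have hij : j.castSucc = i.succ := Fin.ext (by simp [h])
      rw [hij, sum_centredInv_mul_consecutive]
      · ring
      all_goals simp [Fin.ext_iff]; try omega
    · have hij : i.castSucc = j.succ := Fin.ext (by simp [h])
      rw [hij]
      simp only [mul_comm (centredInv j.succ _ _)]
      rw [sum_centredInv_mul_consecutive]
      · ring
      all_goals simp [Fin.ext_iff]; try omega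
  · rw [mul_zero]
    unfold Neighbours at h₂
    apply sum_centredInv_mul_of_disjoint <;> simp [Fin.ext_iff] at * <;> omega

/-- The diagonal contributes `(n + 1) / 4` and the `2 n` adjacent pairs contribute `-n / 6`. -/
lemma sum_covariance (n : ℕ) :
    ∑ i : Fin (n + 1), ∑ j : Fin (n + 1),
      (if i = j then (1 / 4 : ℝ) else if Neighbours i j then -1 / 12 else 0) = (n + 3) / 12 := by
  induction n with
  | zero => simp; norm_num
  | succ n ih =>
    have hcs : ∀ i j : Fin (n + 1), Neighbours i.castSucc j.castSucc ↔ Neighbours i j :=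
      fun i j => by simp [Neighbours]
    have hrow : ∀ i : Fin (n + 1), Neighbours i.castSucc (Fin.last (n + 1)) ↔ i = Fin.last n :=
      fun i => by simp [Neighbours, Fin.ext_iff]; omega
    have hcol : ∀ i : Fin (n + 1), Neighbours (Fin.last (n + 1)) i.castSucc ↔ i = Fin.last n :=
      fun i => by simp [Neighbours, Fin.ext_iff]; omega
    have hne : ∀ i : Fin (n + 1), Fin.last (n + 1) ≠ i.castSucc :=
      fun i => (Fin.castSucc_ne_last i).symm
    rw [Fin.sum_univ_castSucc]
    simp only [Fin.sum_univ_castSucc (n := n + 1), Finset.sum_add_distrib, Fin.castSucc_inj, hcs,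
      hrow, hcol, Fin.castSucc_ne_last, hne, if_false, if_true, ih, Finset.sum_ite_eq',
      Finset.mem_univ]
    push_cast
    ring

lemma sum_des_sub_half_sq (n : ℕ) :
    ∑ w : Equiv.Perm (Fin (n + 2)), ((des w : ℝ) - (n + 1 : ℕ) / 2) ^ 2 =
      ((n + 2).factorial : ℝ) * ((n + 3) / 12) := by
  simp only [des_sub_half, sq, Finset.sum_mul_sum]
  rw [Finset.sum_comm, ← sum_covariance, Finset.mul_sum]
  refine Finset.sum_congr rfl fun i _ => ?_
  rw [Finset.sum_comm, Finset.mul_sum]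
  exact Finset.sum_congr rfl fun j _ => sum_centredInv_mul_eq i j

lemma sum_des_sub_half (n : ℕ) :
    ∑ w : Equiv.Perm (Fin (n + 1)), ((des w : ℝ) - n / 2) = 0 := by
  simp only [des_sub_half]
  rw [Finset.sum_comm]
  exact Finset.sum_eq_zero fun i _ => sum_centredInv (Fin.castSucc_lt_succ).ne

lemma sum_sign_mul_des_sub_half {n : ℕ} (hn : 4 ≤ n + 1) :
    ∑ w : Equiv.Perm (Fin (n + 1)), ((Equiv.Perm.sign w : ℤ) : ℝ) * ((des w : ℝ) - n / 2) = 0 := by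
  simp only [des_sub_half, Finset.mul_sum]
  rw [Finset.sum_comm]
  exact Finset.sum_eq_zero fun i _ => sum_sign_mul_centredInv hn _ _

lemma sum_sign_mul_des_sub_half_sq {n : ℕ} (hn : 6 ≤ n + 1) :
    ∑ w : Equiv.Perm (Fin (n + 1)),
      ((Equiv.Perm.sign w : ℤ) : ℝ) * ((des w : ℝ) - n / 2) ^ 2 = 0 := by
  simp only [des_sub_half, sq, Finset.sum_mul_sum]
  simp only [Finset.mul_sum]
  rw [Finset.sum_comm]
  refine Finset.sum_eq_zero fun i _ => ?_
  rw [Finset.sum_comm]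
  exact Finset.sum_eq_zero fun j _ => sum_sign_mul_centredInv_mul hn _ _ _ _

/-! ### Uniform random variables and their descents -/

/-- The uniform law on the unit interval. -/
noncomputable def unitUniform : Measure ℝ := volume.restrict (Set.Ico 0 1)

instance : IsProbabilityMeasure unitUniform := ⟨by simp [unitUniform]⟩

lemma integral_unitUniform {E : Type*} [NormedAddCommGroup E] [NormedSpace ℝ E] (f : ℝ → E) :
    ∫ x, f x ∂unitUniform = ∫ x in (0 : ℝ)..1, f x := by
  rw [unitUniform, intervalIntegral.integral_of_le zero_le_one, integral_Ico_eq_integral_Ioc]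

lemma ae_unitUniform : ∀ᵐ x ∂unitUniform, x ∈ Set.Ico (0 : ℝ) 1 :=
  ae_restrict_mem measurableSet_Ico

/-- The uniform law is invariant under rotations of the circle `ℝ / ℤ`. -/
lemma integral_unitUniform_rotate (g : ℝ → ℂ) {y : ℝ} (hy : y ∈ Set.Ico (0 : ℝ) 1) :
    ∫ x, g (x - y + if x < y then 1 else 0) ∂unitUniform = ∫ x, g x ∂unitUniform := by
  have hper : Function.Periodic (fun x => g (Int.fract x)) 1 := fun x => by simp
  calc ∫ x, g (x - y + if x < y then 1 else 0) ∂unitUniform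
      = ∫ x, g (Int.fract (x - y)) ∂unitUniform := by
        refine integral_congr_ae (ae_unitUniform.mono fun x hx => ?_)
        simp only
        congr 1
        rw [eq_comm, Int.fract_eq_iff]
        obtain ⟨hx0, hx1⟩ := hx
        obtain ⟨hy0, hy1⟩ := hy
        split_ifs with h
        · exact ⟨by linarith, by linarith, -1, by push_cast; ring⟩
        · exact ⟨by linarith, by linarith, 0, by push_cast; ring⟩
    _ = ∫ x, g (Int.fract x) ∂unitUniform := by
        rw [integral_unitUniform, integral_unitUniform,
          intervalIntegral.integral_comp_sub_right (fun x => g (Int.fract x)) y]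
        have := hper.intervalIntegral_add_eq (-y) 0
        rwa [zero_add, show -y + 1 = 1 - y by ring, ← zero_sub] at this
    _ = ∫ x, g x ∂unitUniform :=
        integral_congr_ae (ae_unitUniform.mono fun x hx => by
          simp only [Int.fract_eq_self.mpr hx])

lemma measurable_seqDescents {n : ℕ} : Measurable (seqDescents : (Fin (n + 1) → ℝ) → ℕ) := by
  have : (seqDescents : (Fin (n + 1) → ℝ) → ℕ) =
      fun v => ∑ i : Fin n, if v i.succ < v i.castSucc then 1 else 0 :=
    funext seqDescents_succ
  rw [this]
  refine Finset.measurable_fun_sum _ fun i _ => Measurable.ite ?_ measurable_const measurable_const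
  exact measurableSet_lt (measurable_pi_apply _) (measurable_pi_apply _)

lemma ae_pi_unitUniform_mem {n : ℕ} (i : Fin n) :
    ∀ᵐ v ∂Measure.pi (fun _ : Fin n => unitUniform), v i ∈ Set.Ico (0 : ℝ) 1 :=
  (measurePreserving_eval (fun _ : Fin n => unitUniform) i).quasiMeasurePreserving.ae
    ae_unitUniform

lemma ae_pi_unitUniform_injective (n : ℕ) :
    ∀ᵐ v ∂Measure.pi (fun _ : Fin n => unitUniform), Function.Injective v := by
  have hne : ∀ i j : Fin n, i ≠ j → ∀ᵐ v ∂(volume : Measure (Fin n → ℝ)), v i ≠ v j := by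
    intro i j hij
    set S : Submodule ℝ (Fin n → ℝ) :=
      LinearMap.ker ((LinearMap.proj i : (Fin n → ℝ) →ₗ[ℝ] ℝ) - LinearMap.proj j)
    have hS : S ≠ ⊤ := by
      intro h
      have : (Pi.single i 1 : Fin n → ℝ) ∈ S := h ▸ Submodule.mem_top
      simp [S, hij] at this
    have h0 := Measure.addHaar_submodule volume S hS
    filter_upwards [compl_mem_ae_iff.mpr h0] with v hv heq
    exact hv (by simp [S, heq])
  have hpi : Measure.pi (fun _ : Fin n => unitUniform) =
      (volume : Measure (Fin n → ℝ)).restrict (Set.univ.pi fun _ => Set.Ico 0 1) := by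
    rw [volume_pi, Measure.restrict_pi_pi]
    rfl
  rw [hpi]
  refine ae_restrict_of_ae ?_
  have hall : ∀ᵐ v ∂(volume : Measure (Fin n → ℝ)), ∀ i j : Fin n, i ≠ j → v i ≠ v j := by
    rw [ae_all_iff]; intro i
    rw [ae_all_iff]; intro j
    by_cases hij : i = j
    · simp [hij]
    · simpa [hij] using hne i j hij
  filter_upwards [hall] with v hv i j hij
  by_contra h
  exact hv i j h hij

/-- Sorting an injective sequence writes it as an increasing sequence composed with a permutation,
and only the permutation matters for the descents. -/
lemma sum_seqDescents_comp_perm {n : ℕ} {v : Fin n → ℝ} (hv : Function.Injective v) (f : ℕ → ℂ) :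
    ∑ w : Equiv.Perm (Fin n), f (seqDescents (v ∘ w)) = ∑ w : Equiv.Perm (Fin n), f (des w) := by
  have hm : StrictMono (v ∘ Tuple.sort v) :=
    (Tuple.monotone_sort v).strictMono_of_injective (hv.comp (Tuple.sort v).injective)
  rw [← Equiv.sum_comp (Equiv.mulLeft (Tuple.sort v))]
  refine Finset.sum_congr rfl fun w _ => ?_
  rw [des_eq_seqDescents, ← seqDescents_comp_strictMono hm]
  rfl

lemma integrable_comp_seqDescents {n : ℕ} {f : ℕ → ℂ} (hf : ∀ k, ‖f k‖ ≤ 1)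
    (w : Equiv.Perm (Fin (n + 1))) :
    Integrable (fun v => f (seqDescents (v ∘ w)))
      (Measure.pi (fun _ : Fin (n + 1) => unitUniform)) := by
  have hw : Measurable fun v : Fin (n + 1) → ℝ => v ∘ w :=
    measurable_pi_lambda _ fun i => measurable_pi_apply _
  exact .of_bound ((measurable_from_nat (f := f)).comp
    (measurable_seqDescents.comp hw)).aestronglyMeasurable 1 (ae_of_all _ fun v => hf _)

/-- The descents of a uniformly random permutation have the same law as the descents of independent
uniform random variables. -/
lemma factorial_mul_integral_seqDescents {n : ℕ} {f : ℕ → ℂ} (hf : ∀ k, ‖f k‖ ≤ 1) :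
    ((n + 1).factorial : ℂ) *
      ∫ v, f (seqDescents v) ∂Measure.pi (fun _ : Fin (n + 1) => unitUniform) =
      ∑ w : Equiv.Perm (Fin (n + 1)), f (des w) := by
  have hw : ∀ w : Equiv.Perm (Fin (n + 1)),
      ∫ v, f (seqDescents (v ∘ w)) ∂Measure.pi (fun _ : Fin (n + 1) => unitUniform) =
        ∫ v, f (seqDescents v) ∂Measure.pi (fun _ : Fin (n + 1) => unitUniform) := by
    intro w
    have hmp := measurePreserving_piCongrLeft (fun _ : Fin (n + 1) => unitUniform) w.symm
    have h := hmp.integral_comp' (fun v => f (seqDescents v))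
    rw [← h]
    refine integral_congr_ae (ae_of_all _ fun v => ?_)
    simp only
    congr 2
    ext i
    obtain ⟨j, rfl⟩ := w.symm.surjective i
    simp only [MeasurableEquiv.piCongrLeft, MeasurableEquiv.coe_mk,
      Equiv.piCongrLeft_apply_apply, Function.comp_apply, Equiv.apply_symm_apply]
  calc _ = ∑ w : Equiv.Perm (Fin (n + 1)),
        ∫ v, f (seqDescents (v ∘ w)) ∂Measure.pi (fun _ : Fin (n + 1) => unitUniform) := by
        simp [hw, Fintype.card_perm]
    _ = ∫ v, ∑ w : Equiv.Perm (Fin (n + 1)), f (seqDescents (v ∘ w))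
          ∂Measure.pi (fun _ : Fin (n + 1) => unitUniform) :=
        (integral_finsetSum _ fun w _ => integrable_comp_seqDescents hf w).symm
    _ = ∫ v, ∑ w : Equiv.Perm (Fin (n + 1)), f (des w)
          ∂Measure.pi (fun _ : Fin (n + 1) => unitUniform) :=
        integral_congr_ae ((ae_pi_unitUniform_injective _).mono fun v hv =>
          sum_seqDescents_comp_perm hv f)
    _ = _ := by simp

/-! ### Characteristic functions -/

/-- The character `x ↦ exp (i r x)` of the real line. -/
noncomputable def realChar (r x : ℝ) : ℂ := Complex.exp (Complex.I * (r * x : ℝ))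

lemma norm_realChar (r x : ℝ) : ‖realChar r x‖ = 1 := by
  rw [realChar, mul_comm, Complex.norm_exp_ofReal_mul_I]

lemma realChar_add (r x y : ℝ) : realChar r (x + y) = realChar r x * realChar r y := by
  rw [realChar, realChar, realChar, ← Complex.exp_add]
  push_cast
  ring_nf

lemma norm_realChar_sub_one_le (r x : ℝ) : ‖realChar r x - 1‖ ≤ |r| * |x| := by
  rw [← abs_mul]
  exact Real.norm_exp_I_mul_ofReal_sub_one_le

lemma measurable_realChar (r : ℝ) : Measurable (realChar r) := by
  unfold realChar
  fun_prop

lemma integrable_realChar_comp {α : Type*} [MeasurableSpace α] {μ : Measure α}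
    [IsFiniteMeasure μ] {Y : α → ℝ} (hY : Measurable Y) (r : ℝ) :
    Integrable (fun a => realChar r (Y a)) μ :=
  .of_bound ((measurable_realChar r).comp hY).aestronglyMeasurable 1
    (ae_of_all _ fun _ => (norm_realChar r _).le)

lemma measurable_last_add_seqDescents (n : ℕ) :
    Measurable fun v : Fin (n + 1) → ℝ => v (Fin.last n) + seqDescents v :=
  (measurable_pi_apply _).add (measurable_from_nat.comp measurable_seqDescents)

/-- For independent uniform `V₀, …, Vₙ` the variable `Vₙ + des V` has the law of a sum of `n + 1`
independent uniform variables: it is the sum of the fractional parts of the increments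
`Vᵢ - Vᵢ₋₁`, and each fractional part is uniform given the past. -/
lemma integral_realChar_last_add_seqDescents (r : ℝ) (n : ℕ) :
    ∫ v, realChar r (v (Fin.last n) + seqDescents v)
      ∂Measure.pi (fun _ : Fin (n + 1) => unitUniform) =
      (∫ x, realChar r x ∂unitUniform) ^ (n + 1) := by
  induction n with
  | zero =>
    have h0 : ∀ v : Fin 1 → ℝ, seqDescents v = 0 := fun v => by simp [seqDescents_succ]
    simp only [h0, Nat.cast_zero, add_zero, zero_add, pow_one]
    have hmp := measurePreserving_eval (fun _ : Fin 1 => unitUniform) (Fin.last 0)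
    have h := integral_map (f := realChar r) (μ := Measure.pi fun _ : Fin 1 => unitUniform)
      hmp.measurable.aemeasurable (measurable_realChar r).aestronglyMeasurable
    rw [hmp.map_eq] at h
    exact h.symm
  | succ n ih =>
    have hmp := (measurePreserving_piFinSuccAbove (fun _ : Fin (n + 2) => unitUniform)
      (Fin.last (n + 1))).symm
    rw [← hmp.integral_comp']
    have hsnoc : ∀ p : ℝ × (Fin (n + 1) → ℝ),
        (MeasurableEquiv.piFinSuccAbove (fun _ : Fin (n + 2) => ℝ) (Fin.last (n + 1))).symm p =
          (Fin.snoc p.2 p.1 : Fin (n + 2) → ℝ) := fun p => by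
      change Fin.insertNth (α := fun _ => ℝ) (Fin.last (n + 1)) p.1 p.2 = _
      rw [Fin.insertNth_last']
    rw [integral_prod_symm]
    swap
    · exact integrable_realChar_comp ((measurable_last_add_seqDescents (n + 1)).comp
        (MeasurableEquiv.measurable _)) r
    rw [pow_succ, ← ih, ← integral_mul_const]
    refine integral_congr_ae ((ae_pi_unitUniform_mem (Fin.last n)).mono fun v hv => ?_)
    simp only [hsnoc]
    rw [← integral_unitUniform_rotate (realChar r) hv, ← integral_const_mul]
    refine integral_congr_ae (ae_of_all _ fun x => ?_)
    simp only [Fin.snoc_last, seqDescents_snoc]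
    rw [← realChar_add]
    congr 1
    push_cast
    ring

/-- The number of descents and a sum of independent uniform variables differ by a term in `[0, 1)`,
which changes the characteristic function at `r` by at most `|r|`. -/
lemma norm_sum_realChar_des_sub_le (r : ℝ) (n : ℕ) :
    ‖(∑ w : Equiv.Perm (Fin (n + 1)), realChar r (des w)) / ((n + 1).factorial : ℂ) -
      (∫ x, realChar r x ∂unitUniform) ^ (n + 1)‖ ≤ |r| := by
  rw [← factorial_mul_integral_seqDescents (f := fun k : ℕ => realChar r k)
      fun k => (norm_realChar r k).le,
    mul_div_cancel_left₀ _ (by exact_mod_cast (n + 1).factorial_ne_zero),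
    ← integral_realChar_last_add_seqDescents, ← integral_sub]
  · have : |r| = |r| * (Measure.pi (fun _ : Fin (n + 1) => unitUniform)).real Set.univ := by simp
    rw [this]
    refine norm_integral_le_of_norm_le_const
      ((ae_pi_unitUniform_mem (Fin.last n)).mono fun v hv => ?_)
    calc _ = ‖realChar r (v (Fin.last n)) - 1‖ := by
          rw [realChar_add, norm_sub_rev, ← sub_one_mul, norm_mul, norm_realChar, mul_one]
      _ ≤ |r| * |v (Fin.last n)| := norm_realChar_sub_one_le _ _
      _ ≤ |r| := mul_le_of_le_one_right (abs_nonneg _) (abs_le.mpr ⟨by linarith [hv.1], hv.2.le⟩)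
  · exact integrable_realChar_comp (measurable_from_nat.comp measurable_seqDescents) r
  · exact integrable_realChar_comp (measurable_last_add_seqDescents n) r

/-- The central limit theorem for sums of independent uniform variables, in terms of
characteristic functions. -/
lemma tendsto_integral_realChar_unitUniform_pow (t : ℝ) :
    Tendsto (fun n : ℕ => (realChar (t / √(n / 12)) (-1 / 2) *
      ∫ x, realChar (t / √(n / 12)) x ∂unitUniform) ^ n) atTop
      (𝓝 (Complex.exp (-t ^ 2 / 2))) := by
  -- The uniform law has mean `1 / 2` and variance `1 / 12`.
  set Y : ℝ → ℝ := fun x => √12 * (x - 1 / 2)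
  have hY : Measurable Y := by fun_prop
  have h0 : ∫ x, Y x ∂unitUniform = 0 := by
    rw [integral_unitUniform]
    simp only [Y]
    rw [intervalIntegral.integral_const_mul, intervalIntegral.integral_sub (by simp) (by simp)]
    norm_num
  have h1 : ∫ x, (Y ^ 2) x ∂unitUniform = 1 := by
    rw [integral_unitUniform]
    simp only [Y, Pi.pow_apply, mul_pow]
    rw [intervalIntegral.integral_const_mul,
      intervalIntegral.integral_comp_sub_right (fun x : ℝ => x ^ 2), integral_pow]
    norm_num
  refine (tendsto_charFun_inv_sqrt_mul_pow hY.aemeasurable h0 h1 t).congr fun n => ?_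
  congr 1
  rw [charFun_apply_real, integral_map hY.aemeasurable (by fun_prop), ← integral_const_mul]
  refine integral_congr_ae (ae_of_all _ fun x => ?_)
  simp only
  rw [← realChar_add, realChar]
  have : √((n : ℝ) / 12) = √n / √12 := Real.sqrt_div' _ (by norm_num)
  rw [this, div_div_eq_mul_div]
  simp only [Y]
  push_cast
  ring_nf

/-! ### The law of the descents of a permutation of given sign -/

/-- The permutations of sign `ε`. -/
def signPerms (ε : ℤˣ) (n : ℕ) : Finset (Equiv.Perm (Fin n)) :=
  Finset.univ.filter fun w => Equiv.Perm.sign w = ε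

lemma two_mul_sum_signPerms {R : Type*} [CommRing R] (ε : ℤˣ) {n : ℕ}
    (F : Equiv.Perm (Fin n) → R) :
    2 * ∑ w ∈ signPerms ε n, F w =
      ∑ w, F w + ((ε : ℤ) : R) * ∑ w, ((Equiv.Perm.sign w : ℤ) : R) * F w := by
  rw [signPerms, Finset.sum_filter, Finset.mul_sum, Finset.mul_sum, ← Finset.sum_add_distrib]
  refine Finset.sum_congr rfl fun w _ => ?_
  rcases Int.units_eq_one_or ε with rfl | rfl <;>
    rcases Int.units_eq_one_or (Equiv.Perm.sign w) with h | h <;> simp [h, two_mul]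

lemma sum_sign_eq_zero (n : ℕ) :
    ∑ w : Equiv.Perm (Fin (n + 2)), ((Equiv.Perm.sign w : ℤ) : ℝ) = 0 := by
  simpa using sum_sign_mul_eq_zero (R := ℝ) (fun _ : Equiv.Perm (Fin (n + 2)) => 1)
    (Equiv.mulLeft (Equiv.swap 0 1)) (fun w => by simp) fun _ => rfl

lemma two_mul_card_signPerms (ε : ℤˣ) (n : ℕ) :
    2 * ((signPerms ε (n + 2)).card : ℝ) = (n + 2).factorial := by
  have h := two_mul_sum_signPerms ε fun _ : Equiv.Perm (Fin (n + 2)) => (1 : ℝ)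
  simp only [mul_one, sum_sign_eq_zero] at h
  simpa [Fintype.card_perm] using h

/-- The coefficient distribution of a sum of monomials is the law of a uniformly chosen exponent. -/
lemma coeffDistribution_sum_X_pow {ι : Type*} (S : Finset ι) (g : ι → ℕ) :
    coeffDistribution (∑ i ∈ S, (Polynomial.X : ℕ[X]) ^ g i) =
      (S.card : ℝ≥0∞)⁻¹ • ∑ i ∈ S, Measure.dirac (g i : ℝ) := by
  have hcoeff : ∀ k, (∑ i ∈ S, (Polynomial.X : ℕ[X]) ^ g i).coeff k =
      (S.filter fun i => g i = k).card := fun k => by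
    simp [Polynomial.finsetSum_coeff, Polynomial.coeff_X_pow, eq_comm]
  have heval : (∑ i ∈ S, (Polynomial.X : ℕ[X]) ^ g i).eval 1 = S.card := by
    simp [Polynomial.eval_finsetSum]
  have hsub : (∑ i ∈ S, (Polynomial.X : ℕ[X]) ^ g i).support ⊆ S.image g := fun k hk => by
    rw [Polynomial.mem_support_iff, hcoeff, Finset.card_ne_zero] at hk
    obtain ⟨i, hi⟩ := hk
    rw [Finset.mem_filter] at hi
    exact Finset.mem_image.mpr ⟨i, hi⟩
  rw [coeffDistribution, Finset.sum_subset hsub fun k _ hk => by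
    rw [Polynomial.notMem_support_iff.mp hk]; simp]
  rw [Finset.smul_sum, ← Finset.sum_fiberwise_of_maps_to (g := g) (t := S.image g)
    (fun i hi => Finset.mem_image_of_mem g hi) fun i =>
      (S.card : ℝ≥0∞)⁻¹ • Measure.dirac (g i : ℝ)]
  refine Finset.sum_congr rfl fun k _ => ?_
  rw [Finset.sum_congr rfl (g := fun _ => (S.card : ℝ≥0∞)⁻¹ • Measure.dirac (k : ℝ)) fun i hi => by
    rw [(Finset.mem_filter.mp hi).2], Finset.sum_const, heval, hcoeff,
    ← Nat.cast_smul_eq_nsmul ℝ≥0∞, smul_smul, div_eq_mul_inv]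

lemma signedEulerianPoly_eq_sum (ε : ℤˣ) (n : ℕ) :
    signedEulerianPoly ε (n + 1) =
      ∑ w ∈ signPerms ε (n + 1), (Polynomial.X : ℕ[X]) ^ (des w + 1) := by
  rw [signedEulerianPoly, ← Finset.sum_fiberwise_of_maps_to (g := fun w => des w + 1)
    (t := Finset.Icc 1 (n + 1)) fun w _ => by
      have := seqDescents_succ_le w
      rw [Finset.mem_Icc, des_eq_seqDescents]; omega]
  refine Finset.sum_congr rfl fun k _ => ?_
  rw [Finset.sum_congr rfl (g := fun _ => (Polynomial.X : ℕ[X]) ^ k) fun w hw => by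
    rw [(Finset.mem_filter.mp hw).2], Finset.sum_const, signPerms, Finset.filter_filter,
    signedEulerian, ← Polynomial.C_mul_X_pow_eq_monomial]
  simp

/-- The law of the number of descents plus one of a uniformly random permutation of sign `ε`. -/
noncomputable def descentLaw (ε : ℤˣ) (n : ℕ) : Measure ℝ :=
  coeffDistribution (signedEulerianPoly ε n)

lemma descentLaw_eq (ε : ℤˣ) (n : ℕ) :
    descentLaw ε (n + 1) = ((signPerms ε (n + 1)).card : ℝ≥0∞)⁻¹ •
      ∑ w ∈ signPerms ε (n + 1), Measure.dirac ((des w + 1 : ℕ) : ℝ) := by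
  rw [descentLaw, signedEulerianPoly_eq_sum, coeffDistribution_sum_X_pow]

lemma card_signPerms_ne_zero (ε : ℤˣ) (n : ℕ) : (signPerms ε (n + 2)).card ≠ 0 := fun h => by
  have := two_mul_card_signPerms ε n
  rw [h] at this
  have h2 := (n + 2).factorial_ne_zero
  simp at this
  exact h2 (by exact_mod_cast this.symm)

lemma isProbabilityMeasure_descentLaw (ε : ℤˣ) (n : ℕ) :
    IsProbabilityMeasure (descentLaw ε (n + 2)) := by
  constructor
  rw [descentLaw_eq]
  simp only [Measure.smul_apply, Measure.coe_finsetSum, Finset.sum_apply, measure_univ,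
    Finset.sum_const, smul_eq_mul, nsmul_eq_mul, mul_one]
  exact ENNReal.inv_mul_cancel (by exact_mod_cast card_signPerms_ne_zero ε n)
    (ENNReal.natCast_ne_top _)

lemma integrable_descentLaw {E : Type*} [NormedAddCommGroup E] (ε : ℤˣ) (n : ℕ) (f : ℝ → E) :
    Integrable f (descentLaw ε (n + 2)) := by
  rw [descentLaw_eq]
  refine Integrable.smul_measure ?_ (ENNReal.inv_ne_top.mpr
    (by exact_mod_cast card_signPerms_ne_zero ε n))
  rw [integrable_finsetSum_measure]
  exact fun w _ => integrable_dirac (by simp)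

lemma integral_descentLaw {𝕜 : Type*} [RCLike 𝕜] (ε : ℤˣ) (n : ℕ) (f : ℝ → 𝕜) :
    ∫ x, f x ∂descentLaw ε (n + 2) =
      (∑ w : Equiv.Perm (Fin (n + 2)), f (des w + 1) +
        ((ε : ℤ) : 𝕜) * ∑ w : Equiv.Perm (Fin (n + 2)),
          ((Equiv.Perm.sign w : ℤ) : 𝕜) * f (des w + 1)) / ((n + 2).factorial : 𝕜) := by
  have hcard : (2 : 𝕜) * ((signPerms ε (n + 2)).card : 𝕜) = (n + 2).factorial := by
    exact_mod_cast two_mul_card_signPerms ε n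
  rw [← two_mul_sum_signPerms, ← hcard, mul_div_mul_left _ _ two_ne_zero, descentLaw_eq,
    integral_smul_measure, integral_finsetSum_measure fun w _ => integrable_dirac (by simp)]
  simp only [integral_dirac]
  rw [ENNReal.toReal_inv, ENNReal.toReal_natCast, RCLike.real_smul_eq_coe_mul, div_eq_inv_mul]
  push_cast
  rfl

lemma integral_id_descentLaw (ε : ℤˣ) {n : ℕ} (hn : 4 ≤ n) :
    ∫ x, x ∂descentLaw ε n = ((n : ℝ) + 1) / 2 := by
  obtain ⟨k, rfl⟩ := Nat.exists_eq_add_of_le' (show 2 ≤ n by omega)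
  have := isProbabilityMeasure_descentLaw ε k
  have hc : ∫ x, (x - (((k + 2 : ℕ) : ℝ) + 1) / 2) ∂descentLaw ε (k + 2) = 0 := by
    have hx : ∀ w : Equiv.Perm (Fin (k + 2)),
        (des w : ℝ) + 1 - (((k + 2 : ℕ) : ℝ) + 1) / 2 = des w - ((k + 1 : ℕ) : ℝ) / 2 := fun w => by
      push_cast; ring
    rw [integral_descentLaw (𝕜 := ℝ)]
    simp only [hx, sum_des_sub_half, sum_sign_mul_des_sub_half hn]
    simp
  rw [integral_sub (integrable_descentLaw ε k _) (integrable_const _)] at hc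
  simpa [sub_eq_zero] using hc

lemma variance_descentLaw (ε : ℤˣ) {n : ℕ} (hn : 6 ≤ n) :
    variance id (descentLaw ε n) = ((n : ℝ) + 1) / 12 := by
  rw [variance_eq_integral aemeasurable_id]
  simp only [id]
  rw [integral_id_descentLaw ε (by omega)]
  obtain ⟨k, rfl⟩ := Nat.exists_eq_add_of_le' (show 2 ≤ n by omega)
  have hx : ∀ w : Equiv.Perm (Fin (k + 2)),
      (des w : ℝ) + 1 - (((k + 2 : ℕ) : ℝ) + 1) / 2 = des w - ((k + 1 : ℕ) : ℝ) / 2 := fun w => by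
    push_cast; ring
  rw [integral_descentLaw (𝕜 := ℝ)]
  simp only [hx, sum_des_sub_half_sq, sum_sign_mul_des_sub_half_sq hn]
  rw [mul_zero, add_zero]
  rw [mul_div_cancel_left₀ _ (by exact_mod_cast (k + 2).factorial_ne_zero)]
  push_cast
  ring

/-! ### Asymptotic normality -/

lemma realChar_pow (r x : ℝ) (k : ℕ) : realChar r x ^ k = realChar r (k * x) := by
  rw [realChar, realChar, ← Complex.exp_nat_mul]
  push_cast
  ring_nf

lemma norm_integral_realChar_le (r : ℝ) : ‖∫ x, realChar r x ∂unitUniform‖ ≤ 1 :=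
  (norm_integral_le_of_norm_le_const (ae_of_all _ fun x => (norm_realChar r x).le)).trans (by simp)

lemma norm_realChar_one_sub_integral_le (r : ℝ) :
    ‖realChar r 1 - ∫ x, realChar r x ∂unitUniform‖ ≤ |r| := by
  have h : realChar r 1 - ∫ x, realChar r x ∂unitUniform =
      ∫ x, (realChar r 1 - realChar r x) ∂unitUniform := by
    rw [integral_sub (integrable_const _) (integrable_realChar_comp measurable_id' r)]
    simp
  have hr : |r| = |r| * unitUniform.real Set.univ := by simp
  rw [h, hr]
  refine norm_integral_le_of_norm_le_const (ae_unitUniform.mono fun x hx => ?_)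
  calc ‖realChar r 1 - realChar r x‖ = ‖realChar r (1 - x) - 1‖ := by
        rw [show (1 : ℝ) = 1 - x + x by ring, realChar_add, ← sub_one_mul, norm_mul, norm_realChar,
          mul_one, add_sub_cancel_right]
    _ ≤ |r| * |1 - x| := norm_realChar_sub_one_le _ _
    _ ≤ |r| := mul_le_of_le_one_right (abs_nonneg _)
        (abs_le.mpr ⟨by linarith [hx.2], by linarith [hx.1]⟩)

/-- The comparison is with `n + 3` uniform variables, one more than the length of the permutations:
the additional one stands for the constant `1` in `des w + 1`, so that the mean `(n + 3) / 2` and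
the variance `(n + 3) / 12` of the sum are exactly those of the law of descents. The two errors of size
`|r|` come from the last uniform variable and from this one, the error `2 / (n + 1)` from the signed
sum. -/
lemma norm_integral_realChar_descentLaw_sub_le (ε : ℤˣ) (n : ℕ) (r : ℝ) :
    ‖∫ x, realChar r x ∂descentLaw ε (n + 2) -
      (∫ x, realChar r x ∂unitUniform) ^ (n + 3)‖ ≤ 2 * |r| + 2 / (n + 1) := by
  set φ := ∫ x, realChar r x ∂unitUniform
  set a : ℂ := (∑ w : Equiv.Perm (Fin (n + 2)), realChar r (des w)) / ((n + 2).factorial : ℂ)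
  set b : ℂ := (∑ w : Equiv.Perm (Fin (n + 2)), ((Equiv.Perm.sign w : ℤ) : ℂ) *
    realChar r (des w)) / ((n + 2).factorial : ℂ)
  have hfac : (0 : ℝ) < (n + 2).factorial := by exact_mod_cast (n + 2).factorial_pos
  have hε : ‖((ε : ℤ) : ℂ)‖ = 1 := by rcases Int.units_eq_one_or ε with rfl | rfl <;> simp
  have ha : ‖a - φ ^ (n + 2)‖ ≤ |r| := norm_sum_realChar_des_sub_le r (n + 1)
  have hb : ‖b‖ ≤ 2 / (n + 1) := by
    have h := norm_sum_sign_mul_des_le (n := n) (fun k : ℕ => realChar r k)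
      fun k => (norm_realChar r k).le
    rw [norm_div, Complex.norm_natCast, div_le_div_iff₀ hfac (by positivity)]
    linarith
  have hsplit : ∫ x, realChar r x ∂descentLaw ε (n + 2) - φ ^ (n + 3) =
      realChar r 1 * (a - φ ^ (n + 2)) + (realChar r 1 - φ) * φ ^ (n + 2) +
        (ε : ℤ) * (realChar r 1 * b) := by
    rw [integral_descentLaw]
    simp only [realChar_add, ← mul_assoc, ← Finset.sum_mul, a, b]
    ring
  rw [hsplit]
  refine (norm_add₃_le).trans ?_
  rw [norm_mul, norm_mul, norm_mul, norm_mul, norm_realChar, hε, norm_pow]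
  have h₁ : ‖realChar r 1 - φ‖ * ‖φ‖ ^ (n + 2) ≤ |r| :=
    (mul_le_of_le_one_right (norm_nonneg _)
      (pow_le_one₀ (norm_nonneg _) (norm_integral_realChar_le r))).trans
      (norm_realChar_one_sub_integral_le r)
  linarith

lemma charFun_map_normalize (μ : Measure ℝ) (m s t : ℝ) :
    charFun (μ.map fun y => (y - m) / s) t =
      realChar (t / s) (-m) * ∫ y, realChar (t / s) y ∂μ := by
  rw [charFun_apply_real, integral_map (by fun_prop) (by fun_prop), ← integral_const_mul]
  refine integral_congr_ae (ae_of_all _ fun y => ?_)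
  simp only
  rw [← realChar_add, realChar]
  push_cast
  ring_nf

lemma tendsto_charFun_descentLaw (ε : ℤˣ) (t : ℝ) :
    Tendsto (fun n : ℕ => charFun ((descentLaw ε (n + 2)).map
      fun y => (y - (((n + 2 : ℕ) : ℝ) + 1) / 2) / √((((n + 2 : ℕ) : ℝ) + 1) / 12)) t)
      atTop (𝓝 (Complex.exp (-t ^ 2 / 2))) := by
  have hlim := (tendsto_integral_realChar_unitUniform_pow t).comp (tendsto_add_atTop_nat 3)
  refine (tendsto_iff_of_dist ?_).mp hlim
  have hr : Tendsto (fun n : ℕ => t / √((n + 3 : ℕ) / 12)) atTop (𝓝 0) :=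
    (Real.tendsto_sqrt_atTop.comp ((tendsto_natCast_atTop_atTop.comp
      (tendsto_add_atTop_nat 3)).atTop_div_const (by norm_num))).const_div_atTop t
  have hbound : Tendsto (fun n : ℕ => 2 * |t / √((n + 3 : ℕ) / 12)| + 2 / ((n : ℝ) + 1))
      atTop (𝓝 0) := by
    have h₁ := (hr.abs.const_mul 2).add (tendsto_one_div_add_atTop_nhds_zero_nat.const_mul (2 : ℝ))
    simpa [div_eq_mul_inv] using h₁
  refine squeeze_zero (fun _ => dist_nonneg) (fun n => ?_) hbound
  rw [dist_comm, dist_eq_norm, charFun_map_normalize]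
  have hN : ((n + 2 : ℕ) : ℝ) + 1 = (n + 3 : ℕ) := by push_cast; ring
  simp only [Function.comp_apply, hN]
  set r := t / √((n + 3 : ℕ) / 12)
  rw [mul_pow, realChar_pow, show ((n + 3 : ℕ) : ℝ) * (-1 / 2) = -((n + 3 : ℕ) / 2) by ring,
    ← mul_sub, norm_mul, norm_realChar, one_mul]
  exact norm_integral_realChar_descentLaw_sub_le ε n r

lemma asymptoticallyNormal_descentLaw (ε : ℤˣ) : AsymptoticallyNormal (descentLaw ε) := by
  refine ⟨?_, fun x => ?_⟩
  · filter_upwards [eventually_ge_atTop 2] with n hn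
    obtain ⟨k, rfl⟩ := Nat.exists_eq_add_of_le' hn
    exact ⟨isProbabilityMeasure_descentLaw ε k,
      (memLp_two_iff_integrable_sq measurable_id.aestronglyMeasurable).mpr
        (integrable_descentLaw ε k _)⟩
  let T : ℕ → ℝ → ℝ := fun n y => (y - ((n : ℝ) + 1) / 2) / √(((n : ℝ) + 1) / 12)
  have hT : ∀ n, Measurable (T n) := fun n => by fun_prop
  have hprob : ∀ n : ℕ, IsProbabilityMeasure ((descentLaw ε (n + 2)).map (T (n + 2))) := fun n =>
    have := isProbabilityMeasure_descentLaw ε n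
    Measure.isProbabilityMeasure_map (hT _).aemeasurable
  let ν : ℕ → ProbabilityMeasure ℝ := fun n => ⟨(descentLaw ε (n + 2)).map (T (n + 2)), hprob n⟩
  have hν : Tendsto ν atTop (𝓝 ⟨gaussianReal 0 1, inferInstance⟩) := by
    refine ProbabilityMeasure.tendsto_of_tendsto_charFun fun t => ?_
    have h := tendsto_charFun_descentLaw ε t
    simpa [ν, T, charFun_gaussianReal, neg_div] using h
  have hcdf := ProbabilityMeasure.tendsto_measure_of_null_frontier_of_tendsto' hν
    (E := Set.Iic x) (by
      rw [frontier_Iic]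
      have := nullSingletonClass_gaussianReal (μ := 0) (v := 1) one_ne_zero
      exact measure_singleton (μ := gaussianReal 0 1) x)
  have hreal := (ENNReal.tendsto_toReal (measure_ne_top (gaussianReal 0 1) (Set.Iic x))).comp hcdf
  rw [← tendsto_add_atTop_iff_nat 2]
  refine hreal.congr' ?_
  filter_upwards [eventually_ge_atTop 4] with n hn
  rw [integral_id_descentLaw ε (by omega), variance_descentLaw ε (by omega)]
  simp only [Function.comp_apply, ν, ProbabilityMeasure.coe_mk]
  rw [Measure.map_apply (hT _) measurableSet_Iic]
  rfl

theorem theorem1p2 (ε : ℤˣ) :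
    AsymptoticallyNormal (fun n => coeffDistribution (signedEulerianPoly ε n)) ∧
    (∀ n : ℕ, 4 ≤ n →
      ∫ x, x ∂(coeffDistribution (signedEulerianPoly ε n)) = ((n : ℝ) + 1) / 2) ∧
    (∀ n : ℕ, 6 ≤ n →
      variance id (coeffDistribution (signedEulerianPoly ε n)) = ((n : ℝ) + 1) / 12) :=
  ⟨asymptoticallyNormal_descentLaw ε, fun _ => integral_id_descentLaw ε,
    fun _ => variance_descentLaw ε⟩
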